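/- For $n\in\mathbb{N}_0$ and $\alpha\in\mathbb{C}$ let $P_n(\alpha)=(-1)^n\binom{\alpha}{n}=\frac{(-1)^n}{n!}\prod_{m=0}^{n-1}(\alpha-m)$. Let $\zeta$ be the Riemann zeta function (meromorphically continued to $\mathbb{C}$) and let $\eta(s)=(1-2^{1-s})\zeta(s)$ for $s\ne 1$, with $\eta(1)=\lim_{s\to1}(1-2^{1-s})\zeta(s)=\log 2$. Then: 1. for every $s\in\mathbb{C}$ with $\operatorname{Re}s>0$, $\eta$ is the Dirichlet eta function: $\eta(s)=\sum_{n=1}^\infty\frac{(-1)^{n-1}}{n^s}$ (limit of partial sums); 2. for every $s\in\mathbb{C}$, $$\eta(s)=\sum_{n=0}^\infty\Big[\sum_{k=0}^n P_k(n)\,\eta(k)\Big]P_n(s);$$ 3. for every $s\in\mathbb{C}$ with $2^{1-s}\neq1$, $$\zeta(s)=\sum_{n=0}^\infty\Big[\sum_{k=0}^n P_k(n)\,\frac{1-2^{1-k}}{1-2^{1-s}}\,\zeta(k)\Big]P_n(s),$$ where for $k=1$ the product $(1-2^{1-k})\zeta(k)$ stands for its limit $\eta(1)=\log 2$. The series in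 2 and 3 converge absolutely. -/

import Mathlib

open Filter Topology

noncomputable section

/-- The `n`-th Pochhammer-Newton polynomial
`P_n(α) = ((-1)^n / n!) * α (α - 1) ⋯ (α - n + 1)`. -/
def pochhammerNewton (n : ℕ) (α : ℂ) : ℂ :=
  (-1) ^ n / (n.factorial : ℂ) * ∏ m ∈ Finset.range n, (α - (m : ℂ))

/-- The (entire) function `η(s) = (1 - 2^(1-s)) ζ(s)`; at `s = 1`, where `ζ` has its pole and the
factor `1 - 2^(1-s)` its zero, the product is given its limit `log 2`. -/
def dirichletEta (s : ℂ) : ℂ :=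
  if s = 1 then (Real.log 2 : ℂ) else (1 - (2 : ℂ) ^ (1 - s)) * riemannZeta s

/-- The value `log 2` at `s = 1` is the limit of `(1 - 2^(1-s)) ζ(s)` as `s → 1`. -/
theorem tendsto_dirichletEta_one :
    Tendsto (fun s : ℂ => (1 - (2 : ℂ) ^ (1 - s)) * riemannZeta s) (𝓝[≠] 1)
      (𝓝 (dirichletEta 1)) := by
  have h1 : HasDerivAt (fun s : ℂ => 1 - (2 : ℂ) ^ (1 - s)) (Complex.log 2) 1 := by
    have h := (((hasDerivAt_id (1 : ℂ)).const_sub 1).const_cpow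
      (c := (2 : ℂ)) (Or.inl two_ne_zero)).const_sub 1
    simpa using h
  have h2 := (hasDerivAt_iff_tendsto_slope.mp h1).mul riemannZeta_residue_one
  have h3 : dirichletEta 1 = Complex.log 2 * 1 := by
    simp [dirichletEta]
  rw [h3]
  refine h2.congr' ?_
  filter_upwards [self_mem_nhdsWithin] with s hs
  have hs' : s - 1 ≠ 0 := sub_ne_zero.mpr hs
  simp only [slope_def_field, sub_self, Complex.cpow_zero, sub_zero]
  field_simp

end

/-!
Let `T` have density `1 / cosh (π t)`. If `f` is bounded and holomorphic on the strip
`|Re z| ≤ 1/2`, shifting the contour across the pole of `1 / sin (π z)` at `0` gives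
`E f(-1/2 + iT) + E f(1/2 + iT) = 2 f(0)`. Applied to `z ↦ (m + 1 + z)⁻ˢ` for `m ≥ 1`, this makes
the alternating sum `∑ (-1)^m (m+1)⁻ˢ` telescope, for `Re s > 0`, to Lindelöf's formula
`η(s) = 1 - E (3/2 + iT)⁻ˢ / 2`; both sides being entire, it holds for all `s` as soon as it holds
for `Re s > 1`, where the alternating sum is `(1 - 2^(1-s)) ζ(s)`. With `y = (3/2 + iT)⁻¹`, which
lies in the disc `|1 - y| < 1`, the binomial series `yˢ = ∑ P_n(s) (1 - y)^n` is the Newton series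
of `s ↦ yˢ`, since `(1 - y)^n = ∑ P_k(n) y^k`. Averaging over `T` is legitimate because
`|P_n(s)|` is at most `(n + R).choose R` for `|s| ≤ R`, and
`∑ (n + R).choose R * |1 - y|^n = (1 - |1 - y|)⁻⁽ᴿ⁺¹⁾` grows only polynomially in `|T|`.
-/

noncomputable section

open MeasureTheory
open scoped Real Interval

/-! ### Contour shift against the hyperbolic secant -/

theorem abs_sinh_im_le_norm_sin (z : ℂ) : |Real.sinh z.im| ≤ ‖Complex.sin z‖ := by
  have h := abs_norm_sub_norm_le (Complex.exp (-z * Complex.I)) (Complex.exp (z * Complex.I))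
  rw [Complex.norm_exp, Complex.norm_exp] at h
  rw [Complex.sin, Real.sinh_eq, norm_div, norm_mul, Complex.norm_I, mul_one, abs_div,
    Complex.norm_ofNat, abs_two]
  gcongr
  simpa using h

theorem mem_integerComplement_of_abs_re_le_half {z : ℂ} (hz : |z.re| ≤ 1 / 2) (h0 : z ≠ 0) :
    z ∈ Complex.integerComplement := by
  rintro ⟨k, rfl⟩
  rw [Complex.intCast_re, ← Int.cast_abs] at hz
  have hk : |k| < 1 := by exact_mod_cast hz.trans_lt one_half_lt_one
  exact h0 (by rw [Int.abs_lt_one_iff.1 hk, Int.cast_zero])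

theorem sin_pi_mul_half_add_mul_I (t : ℝ) :
    Complex.sin (π * (((1 / 2 : ℝ) : ℂ) + t * Complex.I)) = Real.cosh (π * t) := by
  rw [show (π : ℂ) * (((1 / 2 : ℝ) : ℂ) + t * Complex.I) = π / 2 + (π * t : ℝ) * Complex.I by
    push_cast; ring, Complex.sin_add_mul_I, Complex.sin_pi_div_two, Complex.cos_pi_div_two,
    Complex.ofReal_cosh]
  ring

theorem sin_pi_mul_neg_half_add_mul_I (t : ℝ) :
    Complex.sin (π * (((-1 / 2 : ℝ) : ℂ) + t * Complex.I)) = -Real.cosh (π * t) := by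
  have h := sin_pi_mul_half_add_mul_I (-t)
  rw [mul_neg, Real.cosh_neg] at h
  rw [← h, ← Complex.sin_neg]
  congr 1
  push_cast
  ring

theorem integral_vertical_line_eq_of_differentiableOn {g : ℂ → ℂ} {a b : ℝ} {B : ℝ → ℝ}
    (hg : DifferentiableOn ℂ g {z | z.re ∈ [[a, b]]})
    (hB : ∀ z : ℂ, z.re ∈ [[a, b]] → z.im ≠ 0 → ‖g z‖ ≤ B |z.im|) (hB0 : Tendsto B atTop (𝓝 0))
    (ha : Integrable fun t : ℝ => g (a + t * Complex.I))
    (hb : Integrable fun t : ℝ => g (b + t * Complex.I)) :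
    ∫ t : ℝ, g (a + t * Complex.I) = ∫ t : ℝ, g (b + t * Complex.I) := by
  have horizontal (σ : ℝ → ℝ) (hσ : ∀ T, |σ T| = |T|) :
      Tendsto (fun T => ∫ x in a..b, g (x + σ T * Complex.I)) atTop (𝓝 0) := by
    refine squeeze_zero_norm' ?_ (by simpa using hB0.mul_const |b - a|)
    filter_upwards [eventually_gt_atTop 0] with T hT
    refine intervalIntegral.norm_integral_le_of_norm_le_const fun x hx => ?_
    have hσT : σ T ≠ 0 := by rw [← abs_pos, hσ, abs_of_pos hT]; exact hT
    simpa [hσ, abs_of_pos hT] using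
      hB (x + σ T * Complex.I) (by simpa using Set.uIoc_subset_uIcc hx) (by simpa using hσT)
  have vertical {c : ℝ} (hc : Integrable fun t : ℝ => g (c + t * Complex.I)) :
      Tendsto (fun T : ℝ => Complex.I • ∫ t in (-T)..T, g (c + t * Complex.I)) atTop
        (𝓝 (Complex.I • ∫ t : ℝ, g (c + t * Complex.I))) :=
    (intervalIntegral_tendsto_integral hc tendsto_neg_atTop_atBot tendsto_id).const_smul _
  have rectangle (T : ℝ) :
      (∫ x in a..b, g (x + (-T : ℝ) * Complex.I)) - (∫ x in a..b, g (x + T * Complex.I))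
        + Complex.I • (∫ t in (-T)..T, g (b + t * Complex.I))
        - Complex.I • (∫ t in (-T)..T, g (a + t * Complex.I)) = 0 := by
    simpa using Complex.integral_boundary_rect_eq_zero_of_differentiableOn g
      ⟨a, -T⟩ ⟨b, T⟩ (hg.mono fun z hz => hz.1)
  have hlim := (((horizontal (fun T => -T) abs_neg).sub (horizontal id fun _ => rfl)).add
    (vertical hb)).sub (vertical ha)
  have h0 := tendsto_nhds_unique hlim (tendsto_const_nhds.congr fun T => (rectangle T).symm)
  rw [sub_self, zero_add, ← smul_sub, smul_eq_zero_iff_right Complex.I_ne_zero, sub_eq_zero] at h0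
  exact h0.symm

theorem one_add_abs_pow_div_cosh_le (k : ℕ) (t : ℝ) :
    (1 + |t|) ^ k / Real.cosh (π * t)
      ≤ 2 * Real.exp 1 * (k + 2).factorial * (1 + t ^ 2)⁻¹ := by
  have hexp : Real.exp |t| ≤ 2 * Real.cosh (π * t) := by
    have hcosh : Real.cosh t ≤ Real.cosh (π * t) := by
      rw [Real.cosh_le_cosh, abs_mul, abs_of_pos Real.pi_pos]
      exact le_mul_of_one_le_left (abs_nonneg t) (by linarith [Real.pi_gt_three])
    have := Real.exp_abs_le t
    rw [Real.cosh_eq] at hcosh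
    linarith
  have hpow : (1 + |t|) ^ k * (1 + t ^ 2) ≤ (1 + |t|) ^ (k + 2) := by
    rw [pow_add]
    gcongr
    nlinarith [abs_nonneg t, sq_abs t]
  have hfact : (1 + |t|) ^ (k + 2) ≤ (k + 2).factorial * Real.exp (1 + |t|) := by
    rw [← div_le_iff₀' (by positivity)]
    exact Real.pow_div_factorial_le_exp _ (by positivity) _
  rw [div_le_iff₀ (Real.cosh_pos _), mul_right_comm, ← div_eq_mul_inv, le_div_iff₀ (by positivity)]
  calc (1 + |t|) ^ k * (1 + t ^ 2)
      ≤ (k + 2).factorial * (Real.exp 1 * Real.exp |t|) := by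
        rw [← Real.exp_add]
        exact hpow.trans hfact
    _ ≤ (k + 2).factorial * (Real.exp 1 * (2 * Real.cosh (π * t))) := by gcongr
    _ = _ := by ring

theorem integrable_one_add_abs_pow_div_cosh (k : ℕ) :
    Integrable fun t : ℝ => (1 + |t|) ^ k / Real.cosh (π * t) := by
  refine (integrable_inv_one_add_sq.const_mul (2 * Real.exp 1 * (k + 2).factorial)).mono'
    (Continuous.aestronglyMeasurable ?_) (ae_of_all _ fun t => ?_)
  · exact (by fun_prop : Continuous fun t : ℝ => (1 + |t|) ^ k).div (by fun_prop)
      fun t => (Real.cosh_pos _).ne'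
  · rw [Real.norm_of_nonneg (by positivity)]
    exact one_add_abs_pow_div_cosh_le k t

theorem tendsto_sinh_atTop : Tendsto Real.sinh atTop atTop :=
  Real.sinhOrderIso.tendsto_atTop

theorem tendsto_sinh_atBot : Tendsto Real.sinh atBot atBot :=
  Real.sinhOrderIso.tendsto_atBot

theorem integral_inv_cosh_pi_mul : ∫ t : ℝ, (Real.cosh (π * t))⁻¹ = 1 := by
  have hderiv (t : ℝ) : HasDerivAt (fun t => Real.arctan (Real.sinh (π * t)) / π)
      (Real.cosh (π * t))⁻¹ t := by
    have h := (((hasDerivAt_id t).const_mul π).sinh.arctan).div_const π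
    refine h.congr_deriv ?_
    have := (Real.cosh_pos (π * t)).ne'
    rw [← Real.cosh_sq']
    simp only [id]
    field_simp
  have hbot := ((Real.tendsto_arctan_atBot.mono_right nhdsWithin_le_nhds).comp
    (tendsto_sinh_atBot.comp (tendsto_id.const_mul_atBot Real.pi_pos))).div_const π
  have htop := ((Real.tendsto_arctan_atTop.mono_right nhdsWithin_le_nhds).comp
    (tendsto_sinh_atTop.comp (tendsto_id.const_mul_atTop Real.pi_pos))).div_const π
  rw [integral_of_hasDerivAt_of_tendsto hderiv
    (by simpa using integrable_one_add_abs_pow_div_cosh 0) hbot htop]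
  have := Real.pi_ne_zero
  field_simp
  norm_num

/-- The hyperbolic secant distribution, normalised to have density `t ↦ 1 / cosh (π t)`. -/
def sechMeasure : Measure ℝ :=
  volume.withDensity fun t => ENNReal.ofReal (Real.cosh (π * t))⁻¹

theorem measurable_sechDensity : Measurable fun t : ℝ => ENNReal.ofReal (Real.cosh (π * t))⁻¹ := by
  fun_prop

theorem integral_sechMeasure {E : Type*} [NormedAddCommGroup E] [NormedSpace ℝ E] (f : ℝ → E) :
    ∫ t, f t ∂sechMeasure = ∫ t, (Real.cosh (π * t))⁻¹ • f t := by
  rw [sechMeasure, integral_withDensity_eq_integral_toReal_smul measurable_sechDensity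
    (ae_of_all _ fun _ => ENNReal.ofReal_lt_top)]
  refine integral_congr_ae (ae_of_all _ fun t => ?_)
  beta_reduce
  rw [ENNReal.toReal_ofReal (inv_nonneg.2 (Real.cosh_pos _).le)]

instance : IsProbabilityMeasure sechMeasure := by
  refine ⟨?_⟩
  rw [sechMeasure, withDensity_apply _ MeasurableSet.univ, Measure.restrict_univ,
    ← ofReal_integral_eq_lintegral_ofReal, integral_inv_cosh_pi_mul, ENNReal.ofReal_one]
  · simpa using integrable_one_add_abs_pow_div_cosh 0
  · exact ae_of_all _ fun t => inv_nonneg.2 (Real.cosh_pos _).le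

theorem integrable_sechMeasure_iff {E : Type*} [NormedAddCommGroup E] [NormedSpace ℝ E]
    {f : ℝ → E} :
    Integrable f sechMeasure ↔ Integrable fun t => (Real.cosh (π * t))⁻¹ • f t := by
  rw [sechMeasure, integrable_withDensity_iff_integrable_smul' measurable_sechDensity
    (ae_of_all _ fun _ => ENNReal.ofReal_lt_top)]
  refine integrable_congr (ae_of_all _ fun t => ?_)
  beta_reduce
  rw [ENNReal.toReal_ofReal (inv_nonneg.2 (Real.cosh_pos _).le)]

theorem integrable_one_add_abs_pow_sechMeasure (k : ℕ) :
    Integrable (fun t : ℝ => (1 + |t|) ^ k) sechMeasure := by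
  rw [integrable_sechMeasure_iff]
  simpa [div_eq_inv_mul] using integrable_one_add_abs_pow_div_cosh k

theorem integrable_comp_vertical_line_sechMeasure {f : ℂ → ℂ} {s : Set ℂ} {a M : ℝ}
    (hf : ContinuousOn f s) (hM : ∀ z ∈ s, ‖f z‖ ≤ M) (hs : ∀ t : ℝ, (a + t * Complex.I) ∈ s) :
    Integrable (fun t : ℝ => f (a + t * Complex.I)) sechMeasure :=
  .of_bound (hf.comp_continuous (by fun_prop) hs).aestronglyMeasurable M
    (ae_of_all _ fun t => hM _ (hs t))

/-- The function `z ↦ f z / sin (π z)` for an `f` vanishing at `0`, with the removable singularity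
at `0` filled in. -/
def divSinPi (f : ℂ → ℂ) (z : ℂ) : ℂ :=
  dslope f 0 z / dslope (fun w => Complex.sin (π * w)) 0 z

theorem divSinPi_of_ne {f : ℂ → ℂ} (hf : f 0 = 0) {z : ℂ} (hz : z ≠ 0) :
    divSinPi f z = f z / Complex.sin (π * z) := by
  rw [divSinPi, dslope_of_ne _ hz, dslope_of_ne _ hz, slope_def_field, slope_def_field]
  simp only [hf, sub_zero, mul_zero, Complex.sin_zero]
  exact div_div_div_cancel_right₀ hz _ _

theorem dslope_sin_pi_mul_ne_zero {z : ℂ} (hz : |z.re| ≤ 1 / 2) :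
    dslope (fun w => Complex.sin (π * w)) 0 z ≠ 0 := by
  rcases eq_or_ne z 0 with rfl | h0
  · have h : HasDerivAt (fun w => Complex.sin (π * w)) π 0 := by
      simpa using ((hasDerivAt_id (0 : ℂ)).const_mul (π : ℂ)).csin
    rw [dslope_same, h.deriv]
    exact Complex.ofReal_ne_zero.2 Real.pi_ne_zero
  · rw [dslope_of_ne _ h0, slope_def_field]
    simpa [h0] using sin_pi_mul_ne_zero (mem_integerComplement_of_abs_re_le_half hz h0)

theorem differentiableOn_divSinPi {f : ℂ → ℂ} (hf : DifferentiableOn ℂ f {z | |z.re| ≤ 1 / 2}) :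
    DifferentiableOn ℂ (divSinPi f) {z | |z.re| ≤ 1 / 2} := by
  have hnhds : {z : ℂ | |z.re| ≤ 1 / 2} ∈ 𝓝 0 :=
    (continuous_abs.comp Complex.continuous_re).continuousAt.preimage_mem_nhds
      (Iic_mem_nhds (by simp))
  exact ((Complex.differentiableOn_dslope hnhds).2 hf).div
    ((Complex.differentiableOn_dslope hnhds).2 (by fun_prop))
    fun z hz => dslope_sin_pi_mul_ne_zero hz

theorem norm_divSinPi_le {f : ℂ → ℂ} {M : ℝ} (hf : f 0 = 0) {z : ℂ} (hM : ‖f z‖ ≤ M)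
    (hz : z.im ≠ 0) : ‖divSinPi f z‖ ≤ M / Real.sinh (π * |z.im|) := by
  have hz0 : z ≠ 0 := fun h => hz (by rw [h, Complex.zero_im])
  have hsinh := abs_sinh_im_le_norm_sin (π * z)
  rw [Complex.im_ofReal_mul, Real.abs_sinh, abs_mul, abs_of_pos Real.pi_pos] at hsinh
  have hpos := Real.sinh_pos_iff.2 (mul_pos Real.pi_pos (abs_pos.2 hz))
  rw [divSinPi_of_ne hf hz0, norm_div]
  exact div_le_div₀ ((norm_nonneg _).trans hM) hM hpos hsinh

theorem integral_sechMeasure_add_eq_zero {f : ℂ → ℂ} {M : ℝ}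
    (hf : DifferentiableOn ℂ f {z | |z.re| ≤ 1 / 2}) (hM : ∀ z : ℂ, |z.re| ≤ 1 / 2 → ‖f z‖ ≤ M)
    (h0 : f 0 = 0) :
    ∫ t : ℝ, f ((-1 / 2 : ℝ) + t * Complex.I) ∂sechMeasure
      + ∫ t : ℝ, f ((1 / 2 : ℝ) + t * Complex.I) ∂sechMeasure = 0 := by
  have hstrip : {z : ℂ | z.re ∈ [[(-1 / 2 : ℝ), 1 / 2]]} = {z | |z.re| ≤ 1 / 2} := by
    ext z
    rw [Set.mem_ofPred_eq, Set.uIcc_of_le (by norm_num), Set.mem_Icc, neg_div, ← abs_le]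
    rfl
  have hint {a : ℝ} (ha : |a| ≤ 1 / 2) :
      Integrable fun t : ℝ => (Real.cosh (π * t))⁻¹ • f (a + t * Complex.I) :=
    integrable_sechMeasure_iff.1
      (integrable_comp_vertical_line_sechMeasure hf.continuousOn hM fun t => by simpa using ha)
  have hright (t : ℝ) : divSinPi f ((1 / 2 : ℝ) + t * Complex.I)
      = (Real.cosh (π * t))⁻¹ • f ((1 / 2 : ℝ) + t * Complex.I) := by
    rw [divSinPi_of_ne h0 fun h => by simpa using congrArg Complex.re h,
      sin_pi_mul_half_add_mul_I, Complex.real_smul, Complex.ofReal_inv, div_eq_inv_mul]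
  have hleft (t : ℝ) : divSinPi f ((-1 / 2 : ℝ) + t * Complex.I)
      = -((Real.cosh (π * t))⁻¹ • f ((-1 / 2 : ℝ) + t * Complex.I)) := by
    rw [divSinPi_of_ne h0 fun h => by simpa using congrArg Complex.re h,
      sin_pi_mul_neg_half_add_mul_I, div_neg, Complex.real_smul, Complex.ofReal_inv,
      div_eq_inv_mul]
  have h := integral_vertical_line_eq_of_differentiableOn (a := -1 / 2) (b := 1 / 2)
    (B := fun y => M / Real.sinh (π * y)) (hstrip ▸ differentiableOn_divSinPi hf)
    (fun z hz hz0 => norm_divSinPi_le h0 (hM z (hstrip.subset hz)) hz0)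
    ((tendsto_sinh_atTop.comp (tendsto_id.const_mul_atTop Real.pi_pos)).const_div_atTop M)
    (by simp only [hleft]; exact (hint (by norm_num)).neg)
    (by simp only [hright]; exact hint (by norm_num))
  simp only [hleft, hright, integral_neg] at h
  rw [integral_sechMeasure, integral_sechMeasure, ← h, add_neg_cancel]

theorem integral_sechMeasure_add_eq_two_mul {f : ℂ → ℂ} {M : ℝ}
    (hf : DifferentiableOn ℂ f {z | |z.re| ≤ 1 / 2}) (hM : ∀ z : ℂ, |z.re| ≤ 1 / 2 → ‖f z‖ ≤ M) :
    ∫ t : ℝ, f ((-1 / 2 : ℝ) + t * Complex.I) ∂sechMeasure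
      + ∫ t : ℝ, f ((1 / 2 : ℝ) + t * Complex.I) ∂sechMeasure = 2 * f 0 := by
  have hint {a : ℝ} (ha : |a| ≤ 1 / 2) :
      Integrable (fun t : ℝ => f (a + t * Complex.I)) sechMeasure :=
    integrable_comp_vertical_line_sechMeasure hf.continuousOn hM fun t => by simpa using ha
  have h := integral_sechMeasure_add_eq_zero (f := fun z => f z - f 0) (M := M + ‖f 0‖)
    (hf.sub_const _) (fun z hz => (norm_sub_le _ _).trans (by gcongr; exact hM z hz)) (sub_self _)
  rw [integral_sub (hint (by norm_num)) (integrable_const _),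
    integral_sub (hint (by norm_num)) (integrable_const _), integral_const,
    probReal_univ, one_smul] at h
  linear_combination h

/-! ### Newton series -/

theorem pochhammerNewton_zero (s : ℂ) : pochhammerNewton 0 s = 1 := by
  simp [pochhammerNewton]

theorem pochhammerNewton_succ (n : ℕ) (s : ℂ) :
    pochhammerNewton (n + 1) s = pochhammerNewton n s * ((n - s) / (n + 1)) := by
  have h : (n.factorial : ℂ) ≠ 0 := Nat.cast_ne_zero.2 n.factorial_ne_zero
  have h' : (n : ℂ) + 1 ≠ 0 := n.cast_add_one_ne_zero
  simp only [pochhammerNewton, Finset.prod_range_succ, Nat.factorial_succ, pow_succ]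
  push_cast
  field_simp
  ring

theorem pochhammerNewton_eq_choose (n : ℕ) (s : ℂ) :
    pochhammerNewton n s = (-1) ^ n * Ring.choose s n := by
  have h : (descPochhammer ℤ n).smeval s = ∏ m ∈ Finset.range n, (s - (m : ℂ)) := by
    rw [← descPochhammer_eval_eq_prod_range, ← Polynomial.aeval_eq_smeval,
      ← Polynomial.eval_map_algebraMap, descPochhammer_map]
  rw [Ring.choose_eq_smul, h, pochhammerNewton, smul_eq_mul]
  ring

theorem differentiable_pochhammerNewton (n : ℕ) : Differentiable ℂ (pochhammerNewton n) := by
  unfold pochhammerNewton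
  fun_prop

theorem norm_pochhammerNewton_le_choose {s : ℂ} {R : ℕ} (hs : ‖s‖ ≤ R) (n : ℕ) :
    ‖pochhammerNewton n s‖ ≤ (n + R).choose R := by
  induction n with
  | zero => simp [pochhammerNewton_zero]
  | succ n ih =>
    have hchoose : ((n + R).choose R : ℝ) * (n + 1 + R) = (n + 1 + R).choose R * (n + 1) := by
      have h := Nat.choose_mul_succ_eq (n + R) R
      rw [show n + R + 1 = n + 1 + R by omega, Nat.add_sub_cancel] at h
      exact_mod_cast h
    have hfactor : ‖(n : ℂ) - s‖ ≤ n + 1 + R := by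
      have h := norm_sub_le (n : ℂ) s
      rw [Complex.norm_natCast] at h
      linarith
    have hn : ‖(n : ℂ) + 1‖ = n + 1 := by
      rw [← Nat.cast_add_one, Complex.norm_natCast, Nat.cast_add_one]
    rw [pochhammerNewton_succ, norm_mul, norm_div, hn, ← mul_div_assoc, div_le_iff₀ (by positivity),
      ← hchoose]
    gcongr

theorem sum_pochhammerNewton_natCast_mul_pow (n : ℕ) (y : ℂ) :
    ∑ k ∈ Finset.range (n + 1), pochhammerNewton k n * y ^ k = (1 - y) ^ n := by
  rw [sub_eq_neg_add, add_pow]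
  refine Finset.sum_congr rfl fun k _ => ?_
  rw [pochhammerNewton_eq_choose, Ring.choose_natCast, neg_pow]
  ring

theorem hasSum_pochhammerNewton_mul_one_sub_pow (s : ℂ) {y : ℂ} (hy : ‖1 - y‖ < 1) :
    HasSum (fun n => pochhammerNewton n s * (1 - y) ^ n) (y ^ s) := by
  have h := (Complex.one_add_cpow_hasFPowerSeriesOnBall_zero (a := s)).hasSum (y := y - 1)
    (by rw [← ENNReal.ofReal_one, Metric.eball_ofReal]; simpa [norm_sub_rev] using hy)
  simp only [binomialSeries_apply, List.ofFn_const, List.prod_replicate, smul_eq_mul, zero_add,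
    add_sub_cancel] at h
  refine h.congr_fun fun n => ?_
  rw [pochhammerNewton_eq_choose, ← neg_sub 1 y, neg_pow (1 - y)]
  ring

/-- `f` is represented at `s` by its Newton series, the interpolation series through the values
`f 0, f 1, f 2, …`. -/
def HasNewtonSeriesAt (f : ℂ → ℂ) (s : ℂ) : Prop :=
  HasSum (fun n : ℕ =>
    (∑ k ∈ Finset.range (n + 1), pochhammerNewton k n * f k) * pochhammerNewton n s) (f s)

theorem hasNewtonSeriesAt_one (s : ℂ) : HasNewtonSeriesAt (fun _ => 1) s := by
  have h := hasSum_pochhammerNewton_mul_one_sub_pow s (y := 1) (by simp)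
  rw [Complex.one_cpow] at h
  refine h.congr_fun fun n => ?_
  rw [← sum_pochhammerNewton_natCast_mul_pow, mul_comm]
  simp only [one_pow]

theorem HasNewtonSeriesAt.sub {f g : ℂ → ℂ} {s : ℂ} (hf : HasNewtonSeriesAt f s)
    (hg : HasNewtonSeriesAt g s) : HasNewtonSeriesAt (fun z => f z - g z) s := by
  refine (HasSum.sub hf hg).congr_fun fun n => ?_
  simp only [mul_sub, Finset.sum_sub_distrib, sub_mul]

theorem HasNewtonSeriesAt.div_const {f : ℂ → ℂ} {s : ℂ} (hf : HasNewtonSeriesAt f s) (c : ℂ) :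
    HasNewtonSeriesAt (fun z => f z / c) s := by
  refine (HasSum.div_const hf c).congr_fun fun n => ?_
  rw [← div_mul_eq_mul_div, Finset.sum_div]
  simp only [mul_div_assoc]

section MixturesOfPowers

variable {α : Type*} [MeasurableSpace α] {μ : Measure α} {y : α → ℂ}

theorem ae_hasSum_choose_mul_norm_one_sub_pow (hy : ∀ᵐ a ∂μ, ‖1 - y a‖ < 1) (R : ℕ) :
    ∀ᵐ a ∂μ, HasSum (fun n => ((n + R).choose R : ℝ) * ‖1 - y a‖ ^ n)
      (1 / (1 - ‖1 - y a‖) ^ (R + 1)) := by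
  filter_upwards [hy] with a ha
  exact hasSum_choose_mul_geometric_of_norm_lt_one R (by simpa using ha)

theorem summable_choose_mul_integral_norm_one_sub_pow (hym : AEStronglyMeasurable y μ)
    (hy : ∀ᵐ a ∂μ, ‖1 - y a‖ < 1) {R : ℕ}
    (hR : Integrable (fun a => 1 / (1 - ‖1 - y a‖) ^ (R + 1)) μ) :
    Summable fun n : ℕ => ((n + R).choose R : ℝ) * ∫ a, ‖1 - y a‖ ^ n ∂μ := by
  have hsum := ae_hasSum_choose_mul_norm_one_sub_pow hy R
  have h := hasSum_integral_of_dominated_convergence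
    (fun (n : ℕ) a => ((n + R).choose R : ℝ) * ‖1 - y a‖ ^ n)
    (fun n => (by fun_prop : AEStronglyMeasurable (fun a => ‖1 - y a‖ ^ n) μ).const_mul _)
    (fun n => ae_of_all _ fun a => (Real.norm_of_nonneg (by positivity)).le)
    (hsum.mono fun a ha => ha.summable)
    (hR.congr (hsum.mono fun a ha => ha.tsum_eq.symm)) hsum
  simpa only [integral_const_mul] using h.summable

theorem hasSum_pochhammerNewton_mul_integral_one_sub_pow (hym : AEStronglyMeasurable y μ)
    (hy : ∀ᵐ a ∂μ, ‖1 - y a‖ < 1) {R : ℕ}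
    (hR : Integrable (fun a => 1 / (1 - ‖1 - y a‖) ^ (R + 1)) μ) {s : ℂ} (hs : ‖s‖ ≤ R) :
    HasSum (fun n => pochhammerNewton n s * ∫ a, (1 - y a) ^ n ∂μ) (∫ a, y a ^ s ∂μ) := by
  have hsum := ae_hasSum_choose_mul_norm_one_sub_pow hy R
  simp only [← integral_const_mul]
  refine hasSum_integral_of_dominated_convergence
    (fun (n : ℕ) a => ((n + R).choose R : ℝ) * ‖1 - y a‖ ^ n)
    (fun n => (by fun_prop : AEStronglyMeasurable (fun a => (1 - y a) ^ n) μ).const_mul _)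
    (fun n => ae_of_all _ fun a => ?_)
    (hsum.mono fun a ha => ha.summable)
    (hR.congr (hsum.mono fun a ha => ha.tsum_eq.symm))
    (hy.mono fun a ha => hasSum_pochhammerNewton_mul_one_sub_pow s ha)
  rw [norm_mul, norm_pow]
  gcongr
  exact norm_pochhammerNewton_le_choose hs n

theorem differentiable_integral_cpow (hym : AEStronglyMeasurable y μ)
    (hy : ∀ᵐ a ∂μ, ‖1 - y a‖ < 1)
    (hR : ∀ R : ℕ, Integrable (fun a => 1 / (1 - ‖1 - y a‖) ^ (R + 1)) μ) :
    Differentiable ℂ fun s : ℂ => ∫ a, y a ^ s ∂μ := by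
  have hseries : (fun s : ℂ => ∫ a, y a ^ s ∂μ)
      = fun s : ℂ => ∑' n, pochhammerNewton n s * ∫ a, (1 - y a) ^ n ∂μ := by
    funext s
    obtain ⟨R, hs⟩ := exists_nat_ge ‖s‖
    exact (hasSum_pochhammerNewton_mul_integral_one_sub_pow hym hy (hR R) hs).tsum_eq.symm
  rw [hseries]
  intro s
  obtain ⟨R, hs⟩ := exists_nat_gt ‖s‖
  refine (Complex.differentiableOn_tsum_of_summable_norm (U := Metric.ball 0 R)
    (summable_choose_mul_integral_norm_one_sub_pow hym hy (hR R))
    (fun n => ((differentiable_pochhammerNewton n).mul_const _).differentiableOn)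
    Metric.isOpen_ball fun n w hw => ?_).differentiableAt
    (Metric.isOpen_ball.mem_nhds (by simpa using hs))
  rw [norm_mul]
  gcongr
  · exact norm_pochhammerNewton_le_choose (by simpa using (mem_ball_zero_iff.1 hw).le) n
  · simpa only [norm_pow] using norm_integral_le_integral_norm fun a => (1 - y a) ^ n

theorem sum_pochhammerNewton_mul_integral_cpow {n : ℕ}
    (hint : ∀ k ≤ n, Integrable (fun a => y a ^ k) μ) :
    ∑ k ∈ Finset.range (n + 1), pochhammerNewton k n * ∫ a, y a ^ (k : ℂ) ∂μ
      = ∫ a, (1 - y a) ^ n ∂μ := by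
  simp only [Complex.cpow_natCast, ← sum_pochhammerNewton_natCast_mul_pow, ← integral_const_mul]
  exact (integral_finsetSum _ fun k hk =>
    (hint k (Finset.mem_range_succ_iff.1 hk)).const_mul _).symm

theorem hasNewtonSeriesAt_integral_cpow (hym : AEStronglyMeasurable y μ)
    (hy : ∀ᵐ a ∂μ, ‖1 - y a‖ < 1)
    (hR : ∀ R : ℕ, Integrable (fun a => 1 / (1 - ‖1 - y a‖) ^ (R + 1)) μ) (s : ℂ) :
    HasNewtonSeriesAt (fun s : ℂ => ∫ a, y a ^ s ∂μ) s := by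
  have hpow (k : ℕ) : Integrable (fun a => y a ^ k) μ := by
    refine ((hR 0).const_mul (2 ^ k)).mono' (hym.pow k) (hy.mono fun a ha => ?_)
    have hle : ‖y a‖ ≤ 2 := by
      have h := norm_sub_le 1 (1 - y a)
      rw [sub_sub_cancel, norm_one] at h
      linarith
    have hone : 1 ≤ 1 / (1 - ‖1 - y a‖) ^ (0 + 1) := by
      rw [zero_add, pow_one, one_le_div (sub_pos.2 ha)]
      linarith [norm_nonneg (1 - y a)]
    rw [norm_pow]
    exact (pow_le_pow_left₀ (norm_nonneg _) hle k).trans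
      (le_mul_of_one_le_right (by positivity) hone)
  obtain ⟨R, hs⟩ := exists_nat_ge ‖s‖
  refine (hasSum_pochhammerNewton_mul_integral_one_sub_pow hym hy (hR R) hs).congr_fun fun n => ?_
  rw [sum_pochhammerNewton_mul_integral_cpow fun k _ => hpow k, mul_comm]

end MixturesOfPowers

/-! ### Lindelöf's formula -/

theorem re_sub_half_div_normSq_le_one_sub_norm {w : ℂ} (hw : w ≠ 0) :
    (w.re - 1 / 2) / Complex.normSq w ≤ 1 - ‖1 - w⁻¹‖ := by
  have hpos : 0 < Complex.normSq w := Complex.normSq_pos.2 hw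
  have hsq : ‖1 - w⁻¹‖ ^ 2 = 1 - 2 * ((w.re - 1 / 2) / Complex.normSq w) := by
    rw [← Complex.normSq_eq_norm_sq, Complex.normSq_sub, map_one, map_inv₀, one_mul,
      Complex.conj_re, Complex.inv_re]
    field_simp
    ring
  nlinarith [sq_nonneg (1 - ‖1 - w⁻¹‖)]

theorem norm_one_sub_inv_lt_one {w : ℂ} (hw : 1 / 2 < w.re) : ‖1 - w⁻¹‖ < 1 := by
  have h0 : w ≠ 0 := fun h => by norm_num [h] at hw
  have h := re_sub_half_div_normSq_le_one_sub_norm h0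
  have hpos := div_pos (sub_pos.2 hw) (Complex.normSq_pos.2 h0)
  linarith

theorem norm_inv_cpow_le {z s : ℂ} (hz : 0 < z.re) (hs : 0 ≤ s.re) :
    ‖z⁻¹ ^ s‖ ≤ Real.exp (π * |s.im|) * z.re ^ (-s.re) := by
  have h0 : z ≠ 0 := fun h => by simp [h] at hz
  have hnorm : ‖z⁻¹‖ ^ s.re ≤ z.re ^ (-s.re) := by
    rw [norm_inv, Real.inv_rpow (norm_nonneg z), ← Real.rpow_neg (norm_nonneg z)]
    exact Real.rpow_le_rpow_of_nonpos hz (Complex.re_le_norm z) (neg_nonpos.2 hs)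
  have harg : -(z⁻¹.arg * s.im) ≤ π * |s.im| := by
    refine (neg_le_abs _).trans ?_
    rw [abs_mul]
    gcongr
    exact Complex.abs_arg_le_pi _
  rw [Complex.norm_cpow_of_ne_zero (inv_ne_zero h0), div_eq_mul_inv, ← Real.exp_neg, mul_comm]
  gcongr

/-- The mean of `(a + iT)⁻ˢ` for `T` distributed according to `sechMeasure`, written as a mean of
`s`-th powers of `(a + iT)⁻¹`, which lies in the disc `|1 - y| < 1` when `a > 1/2`. -/
def sechMean (a : ℝ) (s : ℂ) : ℂ :=
  ∫ t : ℝ, (a + t * Complex.I)⁻¹ ^ s ∂sechMeasure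

theorem aestronglyMeasurable_inv_add_mul_I (a : ℝ) :
    AEStronglyMeasurable (fun t : ℝ => ((a : ℂ) + t * Complex.I)⁻¹) sechMeasure := by
  fun_prop

theorem normSq_add_mul_I_le (a t : ℝ) :
    Complex.normSq (a + t * Complex.I) ≤ (1 + |a|) ^ 2 * (1 + |t|) ^ 2 := by
  rw [Complex.normSq_add_mul_I, ← mul_pow]
  have := mul_nonneg (abs_nonneg a) (abs_nonneg t)
  nlinarith [abs_nonneg a, abs_nonneg t, sq_abs a, sq_abs t]

theorem one_div_one_sub_norm_one_sub_inv_le {w : ℂ} (hw : 1 / 2 < w.re) :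
    1 / (1 - ‖1 - w⁻¹‖) ≤ Complex.normSq w / (w.re - 1 / 2) := by
  have h0 : w ≠ 0 := fun h => by norm_num [h] at hw
  rw [← one_div_div (w.re - 1 / 2)]
  exact one_div_le_one_div_of_le (div_pos (sub_pos.2 hw) (Complex.normSq_pos.2 h0))
    (re_sub_half_div_normSq_le_one_sub_norm h0)

section HalfPlane

variable {a : ℝ} (ha : 1 / 2 < a)
include ha

theorem ae_norm_one_sub_inv_add_mul_I_lt_one :
    ∀ᵐ t : ℝ ∂sechMeasure, ‖1 - ((a : ℂ) + t * Complex.I)⁻¹‖ < 1 :=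
  ae_of_all _ fun t => norm_one_sub_inv_lt_one (by simpa using ha)

theorem integrable_one_div_one_sub_norm_pow (k : ℕ) :
    Integrable (fun t : ℝ => 1 / (1 - ‖1 - ((a : ℂ) + t * Complex.I)⁻¹‖) ^ k) sechMeasure := by
  refine ((integrable_one_add_abs_pow_sechMeasure (2 * k)).const_mul
    (((1 + |a|) ^ 2 / (a - 1 / 2)) ^ k)).mono' ?_ (ae_of_all _ fun t => ?_)
  · exact Measurable.aestronglyMeasurable (by fun_prop)
  · have hre : ((a : ℂ) + t * Complex.I).re = a := by simp
    have hpos := sub_pos.2 (norm_one_sub_inv_lt_one (hre.symm ▸ ha))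
    have hle := one_div_one_sub_norm_one_sub_inv_le (hre.symm ▸ ha)
    have ha' := sub_pos.2 ha
    rw [hre] at hle
    rw [Real.norm_of_nonneg (by positivity), ← one_div_pow, pow_mul, ← mul_pow, div_mul_eq_mul_div]
    refine pow_le_pow_left₀ (by positivity) (hle.trans ?_) k
    gcongr
    exact normSq_add_mul_I_le a t

theorem differentiable_sechMean : Differentiable ℂ (sechMean a) :=
  differentiable_integral_cpow (aestronglyMeasurable_inv_add_mul_I a)
    (ae_norm_one_sub_inv_add_mul_I_lt_one ha)
    fun R => integrable_one_div_one_sub_norm_pow ha (R + 1)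

theorem hasNewtonSeriesAt_sechMean (s : ℂ) : HasNewtonSeriesAt (sechMean a) s :=
  hasNewtonSeriesAt_integral_cpow (aestronglyMeasurable_inv_add_mul_I a)
    (ae_norm_one_sub_inv_add_mul_I_lt_one ha)
    (fun R => integrable_one_div_one_sub_norm_pow ha (R + 1)) s

end HalfPlane

theorem norm_sechMean_le {a : ℝ} (ha : 0 < a) {s : ℂ} (hs : 0 ≤ s.re) :
    ‖sechMean a s‖ ≤ Real.exp (π * |s.im|) * a ^ (-s.re) := by
  have h := norm_integral_le_of_norm_le_const (μ := sechMeasure)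
    (f := fun t : ℝ => ((a : ℂ) + t * Complex.I)⁻¹ ^ s) (ae_of_all _ fun t => by
      simpa using norm_inv_cpow_le (z := a + t * Complex.I) (by simpa using ha) hs)
  rwa [probReal_univ, mul_one] at h

theorem tendsto_sechMean_atTop {s : ℂ} (hs : 0 < s.re) :
    Tendsto (fun a => sechMean a s) atTop (𝓝 0) := by
  have hbound := (tendsto_rpow_neg_atTop hs).const_mul (Real.exp (π * |s.im|))
  rw [mul_zero] at hbound
  refine squeeze_zero_norm' ?_ hbound
  filter_upwards [eventually_gt_atTop 0] with a ha using norm_sechMean_le ha hs.le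

theorem sechMean_add_sechMean_add_one {a : ℝ} (ha : 0 < a) {s : ℂ} (hs : 0 ≤ s.re) :
    sechMean a s + sechMean (a + 1) s = 2 * ((a + 1 / 2 : ℝ) : ℂ)⁻¹ ^ s := by
  have hre {z : ℂ} (hz : |z.re| ≤ 1 / 2) : a ≤ ((a + 1 / 2 : ℝ) + z : ℂ).re := by
    rw [Complex.add_re, Complex.ofReal_re]
    linarith [neg_le_of_abs_le hz]
  have h := integral_sechMeasure_add_eq_two_mul
    (f := fun z => ((a + 1 / 2 : ℝ) + z : ℂ)⁻¹ ^ s) (M := Real.exp (π * |s.im|) * a ^ (-s.re))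
    (fun z hz => ?_) fun z hz => ?_
  · rw [sechMean, sechMean]
    convert h using 6 <;> push_cast <;> ring
  · have hpos := ha.trans_le (hre hz)
    have h0 : ((a + 1 / 2 : ℝ) + z : ℂ) ≠ 0 := fun h => by
      rw [h, Complex.zero_re] at hpos
      exact hpos.false
    have hslit : ((a + 1 / 2 : ℝ) + z : ℂ)⁻¹ ∈ Complex.slitPlane := by
      rw [Complex.mem_slitPlane_iff, Complex.inv_re]
      exact .inl (div_pos hpos (Complex.normSq_pos.2 h0))
    have hinv : DifferentiableAt ℂ (fun z : ℂ => ((a + 1 / 2 : ℝ) + z : ℂ)⁻¹) z := by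
      fun_prop (disch := exact h0)
    exact (hinv.cpow_const hslit).differentiableWithinAt
  · refine (norm_inv_cpow_le (ha.trans_le (hre hz)) hs).trans ?_
    gcongr ?_ * ?_
    exact Real.rpow_le_rpow_of_nonpos ha (hre hz) (neg_nonpos.2 hs)

theorem sum_range_alternating_eq_sechMean {s : ℂ} (hs : 0 ≤ s.re) (N : ℕ) :
    ∑ m ∈ Finset.range (N + 1), (-1 : ℂ) ^ m / ((m : ℂ) + 1) ^ s
      = 1 - sechMean (3 / 2) s / 2 + (-1) ^ N * (sechMean (N + 3 / 2) s / 2) := by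
  induction N with
  | zero => simp
  | succ N ih =>
    have h := sechMean_add_sechMean_add_one (a := N + 3 / 2) (by positivity) hs
    have hterm : (((N + 3 / 2 + 1 / 2 : ℝ) : ℂ))⁻¹ ^ s = 1 / (((N + 1 : ℕ) : ℂ) + 1) ^ s := by
      rw [show ((N + 3 / 2 + 1 / 2 : ℝ) : ℂ) = (N + 2 : ℕ) by push_cast; ring,
        Complex.inv_cpow _ _ (by rw [Complex.natCast_arg]; exact Real.pi_ne_zero.symm), one_div]
      push_cast
      ring_nf
    rw [hterm, show (N : ℝ) + 3 / 2 + 1 = (N + 1 : ℕ) + 3 / 2 by push_cast; ring] at h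
    rw [Finset.sum_range_succ, ih]
    linear_combination (-1) ^ N / 2 * h

theorem tendsto_sum_range_alternating {s : ℂ} (hs : 0 < s.re) :
    Tendsto (fun N : ℕ => ∑ m ∈ Finset.range N, (-1 : ℂ) ^ m / ((m : ℂ) + 1) ^ s) atTop
      (𝓝 (1 - sechMean (3 / 2) s / 2)) := by
  rw [← tendsto_add_atTop_iff_nat 1]
  simp only [sum_range_alternating_eq_sechMean hs.le]
  have hshift : Tendsto (fun N : ℕ => sechMean (N + 3 / 2) s / 2) atTop (𝓝 0) := by
    have h := ((tendsto_sechMean_atTop hs).comp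
      (tendsto_atTop_add_const_right _ (3 / 2) tendsto_natCast_atTop_atTop)).div_const 2
    simpa only [zero_div, Function.comp_apply] using h
  have hsign : Tendsto (fun N : ℕ => (-1 : ℂ) ^ N * (sechMean (N + 3 / 2) s / 2)) atTop (𝓝 0) := by
    rw [tendsto_zero_iff_norm_tendsto_zero] at hshift ⊢
    simpa using hshift
  simpa only [add_zero] using hsign.const_add _

theorem tsum_alternating_of_odd_eq_mul {u : ℕ → ℂ} {c : ℂ} (hu : Summable u)
    (hodd : ∀ k, u (2 * k + 1) = c * u k) :
    ∑' m, (-1 : ℂ) ^ m * u m = (1 - 2 * c) * ∑' m, u m := by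
  have he : Summable fun k => u (2 * k) := hu.comp_injective (mul_right_injective₀ two_ne_zero)
  have ho : Summable fun k => u (2 * k + 1) := by
    simp only [hodd]
    exact hu.mul_left _
  have hsum := tsum_even_add_odd he ho
  have halt := tsum_even_add_odd (f := fun m : ℕ => (-1 : ℂ) ^ m * u m)
    (by simpa [pow_mul] using he) (by simpa [pow_succ, pow_mul] using ho.neg)
  simp only [pow_add, pow_one, pow_mul, neg_one_sq, one_pow, one_mul, neg_mul, tsum_neg] at halt
  simp only [hodd, tsum_mul_left] at hsum halt
  linear_combination hsum - halt

theorem one_div_odd_add_one_cpow (k : ℕ) (s : ℂ) :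
    1 / (((2 * k + 1 : ℕ) : ℂ) + 1) ^ s = (2 : ℂ) ^ (-s) * (1 / ((k : ℂ) + 1) ^ s) := by
  have h := Complex.natCast_mul_natCast_cpow 2 (k + 1) s
  have hdouble : ((2 * k + 1 : ℕ) : ℂ) + 1 = ((2 : ℕ) : ℂ) * ((k + 1 : ℕ) : ℂ) := by
    push_cast
    ring
  rw [hdouble, h, Complex.cpow_neg, one_div, mul_inv, one_div, Nat.cast_ofNat, Nat.cast_add_one k]

theorem dirichletEta_of_ne_one {s : ℂ} (hs : s ≠ 1) :
    dirichletEta s = (1 - (2 : ℂ) ^ (1 - s)) * riemannZeta s :=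
  if_neg hs

theorem hasSum_alternating_dirichletEta {s : ℂ} (hs : 1 < s.re) :
    HasSum (fun m : ℕ => (-1 : ℂ) ^ m / ((m : ℂ) + 1) ^ s) (dirichletEta s) := by
  have hs1 : s ≠ 1 := fun h => by simp [h] at hs
  have hu : Summable fun m : ℕ => 1 / ((m : ℂ) + 1) ^ s := by
    simpa using (summable_nat_add_iff 1).2 (Complex.summable_one_div_nat_cpow.2 hs)
  have halt : Summable fun m : ℕ => (-1 : ℂ) ^ m * (1 / ((m : ℂ) + 1) ^ s) :=
    .of_norm (by simpa using hu.norm)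
  have h := tsum_alternating_of_odd_eq_mul hu fun k => one_div_odd_add_one_cpow k s
  rw [← zeta_eq_tsum_one_div_nat_add_one_cpow hs, show (1 : ℂ) - 2 * 2 ^ (-s) = 1 - 2 ^ (1 - s) by
    rw [sub_eq_add_neg 1 s, Complex.cpow_add _ _ two_ne_zero, Complex.cpow_one],
    ← dirichletEta_of_ne_one hs1] at h
  rw [← h]
  simpa only [mul_one_div] using halt.hasSum

theorem differentiable_dirichletEta : Differentiable ℂ dirichletEta := by
  have hne {s : ℂ} (hs : s ≠ 1) : DifferentiableAt ℂ dirichletEta s := by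
    have h : DifferentiableAt ℂ (fun s : ℂ => (1 - (2 : ℂ) ^ (1 - s)) * riemannZeta s) s :=
      ((differentiableAt_const _).sub (((differentiableAt_const _).sub
        differentiableAt_id).const_cpow (Or.inl two_ne_zero))).mul
        (differentiableAt_riemannZeta hs)
    exact h.congr_of_eventuallyEq
      ((isOpen_ne.eventually_mem hs).mono fun w hw => dirichletEta_of_ne_one hw)
  intro s
  rcases eq_or_ne s 1 with rfl | hs
  · refine (Complex.analyticAt_of_differentiable_on_punctured_nhds_of_continuousAt
      (eventually_mem_nhdsWithin.mono fun w hw => hne hw) ?_).differentiableAt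
    rw [continuousAt_iff_punctured_nhds]
    exact tendsto_dirichletEta_one.congr'
      (eventually_mem_nhdsWithin.mono fun w hw => (dirichletEta_of_ne_one hw).symm)
  · exact hne hs

theorem dirichletEta_eq_one_sub_sechMean (s : ℂ) :
    dirichletEta s = 1 - sechMean (3 / 2) s / 2 := by
  have hsech : Differentiable ℂ fun s => 1 - sechMean (3 / 2) s / 2 :=
    ((differentiable_sechMean (by norm_num)).div_const 2).const_sub 1
  refine congrFun (AnalyticOnNhd.eq_of_eventuallyEq (𝕜 := ℂ) (z₀ := 2)
    (differentiable_dirichletEta.differentiableOn.analyticOnNhd isOpen_univ)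
    (hsech.differentiableOn.analyticOnNhd isOpen_univ) ?_) s
  have hopen : IsOpen {z : ℂ | 1 < z.re} := isOpen_lt continuous_const Complex.continuous_re
  filter_upwards [hopen.mem_nhds (show (2 : ℂ) ∈ {z : ℂ | 1 < z.re} by simp)] with z hz
  exact tendsto_nhds_unique (hasSum_alternating_dirichletEta hz).tendsto_sum_nat
    (tendsto_sum_range_alternating (zero_lt_one.trans hz))

theorem hasNewtonSeriesAt_dirichletEta (s : ℂ) : HasNewtonSeriesAt dirichletEta s := by
  rw [funext dirichletEta_eq_one_sub_sechMean]
  exact (hasNewtonSeriesAt_one s).sub ((hasNewtonSeriesAt_sechMean (by norm_num) s).div_const 2)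

theorem dirichletEta_div_eq_riemannZeta {s : ℂ} (hs : (2 : ℂ) ^ (1 - s) ≠ 1) :
    dirichletEta s / (1 - (2 : ℂ) ^ (1 - s)) = riemannZeta s := by
  have hs1 : s ≠ 1 := fun h => hs (by simp [h])
  rw [dirichletEta_of_ne_one hs1, mul_div_cancel_left₀ _ (sub_ne_zero.2 hs.symm)]

end

theorem theoremT :
    -- `η` is the sum of the alternating Dirichlet series wherever that series converges
    (∀ s : ℂ, 0 < s.re →
      Tendsto (fun N : ℕ => ∑ m ∈ Finset.range N, (-1 : ℂ) ^ m / ((m : ℂ) + 1) ^ s) atTop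
        (𝓝 (dirichletEta s))) ∧
    -- the Newton series of `η`
    (∀ s : ℂ,
      HasSum
        (fun n : ℕ =>
          (∑ k ∈ Finset.range (n + 1), pochhammerNewton k (n : ℂ) * dirichletEta (k : ℂ)) *
            pochhammerNewton n s)
        (dirichletEta s)) ∧
    -- the interpolation of `ζ`
    (∀ s : ℂ, (2 : ℂ) ^ (1 - s) ≠ 1 →
      HasSum
        (fun n : ℕ =>
          (∑ k ∈ Finset.range (n + 1),
            pochhammerNewton k (n : ℂ) * (dirichletEta (k : ℂ) / (1 - (2 : ℂ) ^ (1 - s)))) *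
            pochhammerNewton n s)
        (riemannZeta s)) := by
  refine ⟨fun s hs => ?_, hasNewtonSeriesAt_dirichletEta, fun s hs => ?_⟩
  · rw [dirichletEta_eq_one_sub_sechMean]
    exact tendsto_sum_range_alternating hs
  · rw [← dirichletEta_div_eq_riemannZeta hs]
    exact (hasNewtonSeriesAt_dirichletEta s).div_const _
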